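/- Let $X$ be a finite-dimensional real Hilbert space, and let $\mathcal{C}$ be a nonempty finite collection of nonempty polyhedral subsets of $X$, where a polyhedral set is an intersection of finitely many closed halfspaces. For $C\in\mathcal{C}$, let $P_C\colon X\to X$ be the projector that maps each point of $X$ to its unique nearest point in $C$. Let $\lambda\in[0,2)$ and let $x_0\in X$. Let $(x_n)_{n\in\mathbb{N}}$ be a sequence in $X$ starting at $x_0$ such that, for every $n\in\mathbb{N}$, $$x_{n+1}=R_nx_n\quad\text{for some}\quad R_n\in\{(1-\mu)\operatorname{Id}+\mu P_C : C\in\mathcal{C},\ \mu\in[0,\lambda]\}.$$ Then the sequence $(x_n)_{n\in\mathbb{N}}$ is bounded. -/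

import Mathlib

section

variable {X : Type*} [NormedAddCommGroup X] [InnerProductSpace ℝ X]

/-- A closed halfspace `{x | ⟪a, x⟫ ≤ β}` with `a ≠ 0`. -/
def IsClosedHalfspace (H : Set X) : Prop :=
  ∃ (a : X) (β : ℝ), a ≠ 0 ∧ H = {x : X | inner ℝ a x ≤ β}

/-- A polyhedral set: the intersection of finitely many closed halfspaces
(the whole space is the intersection of the empty family). -/
def IsPolyhedralSet (C : Set X) : Prop :=
  ∃ 𝓗 : Set (Set X), 𝓗.Finite ∧ (∀ H ∈ 𝓗, IsClosedHalfspace H) ∧ C = ⋂₀ 𝓗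

/-- `p` is a nearest point to `x` in `C`. -/
def IsNearestPoint (C : Set X) (x p : X) : Prop :=
  p ∈ C ∧ ∀ z ∈ C, ‖x - p‖ ≤ ‖x - z‖

open Classical in
/-- The orthogonal projector `P_C`: it sends `x` to its nearest point in `C`. That point exists and
is unique when `C` is nonempty, closed and convex; `x` is a dummy value where no nearest point
exists. -/
noncomputable def projector (C : Set X) (x : X) : X :=
  if h : ∃ p, IsNearestPoint C x p then h.choose else x

/-- The set of relaxed projectors `(1 - μ) Id + μ P_C` with `C ∈ 𝒞` and `μ ∈ Λ`. -/
def relaxedProjectors (𝒞 : Set (Set X)) (Λ : Set ℝ) : Set (X → X) :=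
  {R | ∃ C ∈ 𝒞, ∃ μ ∈ Λ, R = fun x => (1 - μ) • x + μ • projector C x}

/-- Polyhedral sets are closed. -/
theorem IsPolyhedralSet.isClosed {C : Set X} (hC : IsPolyhedralSet C) : IsClosed C := by
  obtain ⟨𝓗, -, h, rfl⟩ := hC
  refine isClosed_sInter fun H hH => ?_
  obtain ⟨a, β, -, rfl⟩ := h H hH
  exact isClosed_le (by fun_prop) continuous_const

/-- Polyhedral sets are convex. -/
theorem IsPolyhedralSet.convex {C : Set X} (hC : IsPolyhedralSet C) : Convex ℝ C := by
  obtain ⟨𝓗, -, h, rfl⟩ := hC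
  refine convex_sInter fun H hH => ?_
  obtain ⟨a, β, -, rfl⟩ := h H hH
  exact convex_halfSpace_le (innerₛₗ ℝ a).isLinear β

/-- Nearest points in a convex set are unique. -/
theorem IsNearestPoint.unique {C : Set X} (hC : Convex ℝ C) {x p q : X}
    (hp : IsNearestPoint C x p) (hq : IsNearestPoint C x q) : p = q := by
  have hm : (2⁻¹ : ℝ) • p + (2⁻¹ : ℝ) • q ∈ C :=
    hC hp.1 hq.1 (by norm_num) (by norm_num) (by norm_num)
  have h1 := hp.2 _ hm
  have h2 := hq.2 _ hp.1
  have h3 := hp.2 _ hq.1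
  have e : x - ((2⁻¹ : ℝ) • p + (2⁻¹ : ℝ) • q) = (2⁻¹ : ℝ) • ((x - p) + (x - q)) := by
    module
  rw [e, norm_smul] at h1
  have h4 := parallelogram_law_with_norm ℝ (x - p) (x - q)
  have e2 : (x - p) - (x - q) = q - p := by abel
  rw [e2] at h4
  have h5 : ‖x - p‖ = ‖x - q‖ := le_antisymm h3 h2
  norm_num at h1
  have h6 : ‖q - p‖ = 0 := by
    nlinarith [norm_nonneg (q - p), norm_nonneg (x - p), norm_nonneg (x - p + (x - q))]
  exact (sub_eq_zero.1 (norm_eq_zero.1 h6)).symm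

/-- The projector onto a nonempty closed subset of a finite-dimensional space attains the
distance. -/
theorem projector_isNearestPoint [FiniteDimensional ℝ X] {C : Set X} (hne : C.Nonempty)
    (hcl : IsClosed C) (x : X) : IsNearestPoint C x (projector C x) := by
  have : ProperSpace X := FiniteDimensional.proper ℝ X
  obtain ⟨p, hp, h⟩ := hcl.exists_infDist_eq_dist hne x
  have hex : ∃ p, IsNearestPoint C x p := by
    refine ⟨p, hp, fun z hz => ?_⟩
    rw [← dist_eq_norm, ← dist_eq_norm, ← h]
    exact Metric.infDist_le_dist_of_mem hz
  rw [projector, dif_pos hex]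
  exact hex.choose_spec

end

/-!
A point `x` and its projection `p` onto a polyhedron `C` satisfy: `x - p` lies in the span `W` of
the normals active at `p`. So `p` is also the projection of `x` onto the affine subspace `c + Wᗮ`,
where `c` is any point of `C` with the same active normals, and only finitely many such subspaces
occur. It remains to treat finitely many affine subspaces `c i + (W i)ᗮ` (Meshulam's theorem).

The relaxation parameter may be fixed to one value `r ∈ (0, 2)`: the convex hull of an orbit of the
semigroup generated by the `r`-relaxed projections is invariant under all smaller relaxations.
For fixed `r`, let `S` be the set of projections occurring in a product. By induction on `S`, the
linear parts of the products that use all of `S` contract the sum of the `W i` by a uniform factor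
`q < 1`. Cut a product into shortest blocks that use all of `S`. Such a block is one projection
after a product using fewer, hence displaces the origin by a bounded amount `D`; so a ball of
radius `D / (1 - q)` is preserved by the blocks.
-/

section RelaxedProjection

variable {X : Type*} [NormedAddCommGroup X] [InnerProductSpace ℝ X]
variable {r μ : ℝ} {c : X} {W : Submodule ℝ X} [W.HasOrthogonalProjection]

/-- The relaxed projection `(1 - μ) Id + μ P_A` onto the affine subspace `A = c + Wᗮ`. It is
described by the normal space `W` rather than the direction of `A` because the normal spaces of
polyhedra are finite-dimensional. For `c = 0` it is linear. -/
noncomputable def relaxedProj (μ : ℝ) (c : X) (W : Submodule ℝ X) [W.HasOrthogonalProjection] :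
    X →ᵃ[ℝ] X where
  toFun x := x - μ • W.starProjection (x - c)
  linear := LinearMap.id - μ • (W.starProjection : X →ₗ[ℝ] X)
  map_vadd' x v := by
    simp only [vadd_eq_add, add_sub_assoc, map_add, LinearMap.sub_apply, LinearMap.id_apply,
      LinearMap.smul_apply, ContinuousLinearMap.coe_coe]
    module

theorem relaxedProj_apply (x : X) : relaxedProj μ c W x = x - μ • W.starProjection (x - c) := rfl

theorem relaxedProj_add (x y : X) :
    relaxedProj μ c W (x + y) = relaxedProj μ 0 W x + relaxedProj μ c W y := by
  simp only [relaxedProj_apply, sub_zero, add_sub_assoc, map_add]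
  module

theorem relaxedProj_mem {V : Submodule ℝ X} (hWV : W ≤ V) {x : X} (hx : x ∈ V) :
    relaxedProj μ c W x ∈ V :=
  V.sub_mem hx (V.smul_mem _ (hWV (W.starProjection_apply_mem _)))

theorem relaxedProj_zero_of_mem_orthogonal {x : X} (hx : x ∈ Wᗮ) : relaxedProj μ 0 W x = x := by
  rw [relaxedProj_apply, sub_zero, W.starProjection_apply_eq_zero_iff.2 hx, smul_zero, sub_zero]

theorem relaxedProj_eq_of_sub_mem {x p : X} (hpc : p - c ∈ Wᗮ) (hxp : x - p ∈ W) :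
    relaxedProj μ c W x = (1 - μ) • x + μ • p := by
  have hproj : W.starProjection (x - c) = x - p :=
    Submodule.eq_starProjection_of_mem_orthogonal hxp (by rwa [sub_sub_sub_cancel_left])
  rw [relaxedProj_apply, hproj]
  module

theorem relaxedProj_eq_lineMap (hr : r ≠ 0) (x : X) :
    relaxedProj μ c W x = AffineMap.lineMap x (relaxedProj r c W x) (μ / r) := by
  rw [AffineMap.lineMap_apply_module', relaxedProj_apply, relaxedProj_apply, sub_sub_cancel_left,
    smul_neg, smul_smul, div_mul_cancel₀ μ hr, sub_eq_neg_add]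

theorem norm_relaxedProj_zero_sq (x : X) :
    ‖relaxedProj μ 0 W x‖ ^ 2 = ‖x‖ ^ 2 - μ * (2 - μ) * ‖W.starProjection x‖ ^ 2 := by
  have hinner : inner ℝ x (W.starProjection x) = ‖W.starProjection x‖ ^ 2 := by
    have h := W.starProjection_inner_eq_zero x _ (W.starProjection_apply_mem x)
    rwa [inner_sub_left, real_inner_self_eq_norm_sq, sub_eq_zero] at h
  rw [relaxedProj_apply, sub_zero, norm_sub_sq_real, real_inner_smul_right, hinner, norm_smul,
    mul_pow, Real.norm_eq_abs, sq_abs]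
  ring

theorem norm_relaxedProj_zero_le (hμ : μ ∈ Set.Icc 0 2) (x : X) :
    ‖relaxedProj μ 0 W x‖ ≤ ‖x‖ := by
  refine (sq_le_sq₀ (norm_nonneg _) (norm_nonneg _)).1 ?_
  rw [norm_relaxedProj_zero_sq]
  exact sub_le_self _ (mul_nonneg (mul_nonneg hμ.1 (sub_nonneg.2 hμ.2)) (sq_nonneg _))

end RelaxedProjection

section Contraction

variable {X : Type*} [NormedAddCommGroup X] [InnerProductSpace ℝ X]

theorem exists_norm_le_mul_norm_starProjection (V W : Submodule ℝ X) [FiniteDimensional ℝ W] :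
    ∃ K : ℝ, ∀ y ∈ (V ⊔ W) ⊓ Vᗮ, ‖y‖ ≤ K * ‖W.starProjection y‖ := by
  let U : Submodule ℝ X := (V ⊔ W) ⊓ Vᗮ
  let f : U →ₗ[ℝ] W := (W.orthogonalProjectionOnto : X →ₗ[ℝ] W).domRestrict U
  have hker : LinearMap.ker f = ⊥ := by
    refine LinearMap.ker_eq_bot'.2 fun ⟨y, hyVW, hyV⟩ hy => Subtype.ext ?_
    have hyW : y ∈ Wᗮ := W.orthogonalProjectionOnto_eq_zero_iff.1 hy
    have hyVW' : y ∈ (V ⊔ W)ᗮ := V.inf_orthogonal W ▸ ⟨hyV, hyW⟩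
    exact (V ⊔ W).orthogonal_disjoint.le_bot ⟨hyVW, hyVW'⟩
  have : FiniteDimensional ℝ U := .of_injective f (LinearMap.ker_eq_bot.1 hker)
  obtain ⟨K, -, hK⟩ := f.exists_antilipschitzWith hker
  refine ⟨K, fun y hy => ?_⟩
  simpa only [dist_zero_right, map_zero] using! hK.le_mul_dist (⟨y, hy⟩ : U) 0

theorem norm_add_sq_of_mem_orthogonal {V : Submodule ℝ X} {y z : X} (hy : y ∈ Vᗮ) (hz : z ∈ V) :
    ‖y + z‖ ^ 2 = ‖y‖ ^ 2 + ‖z‖ ^ 2 := by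
  rw [norm_add_sq_real, V.inner_left_of_mem_orthogonal hz hy, mul_zero, add_zero]

/-- A definite loss in norm of the component in `V` (from `z` to `z'`), followed by a projection
with normal space `W`, produces a definite loss in norm on `V ⊔ W`. Either the loss in `V` is
already comparable to `‖y + z‖ ^ 2`, or `y` dominates and the projection moves it substantially. -/
theorem exists_norm_sq_le_mul_loss (V W : Submodule ℝ X) [FiniteDimensional ℝ W] {r : ℝ}
    (hr : r ∈ Set.Ioo 0 2) {C : ℝ} (hC : 0 ≤ C) :
    ∃ C' : ℝ, 0 ≤ C' ∧ ∀ y ∈ (V ⊔ W) ⊓ Vᗮ, ∀ z ∈ V, ∀ z' ∈ V, ‖z'‖ ≤ ‖z‖ →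
      ‖z‖ ^ 2 ≤ C * (‖z‖ ^ 2 - ‖z'‖ ^ 2) →
      ‖y + z‖ ^ 2 ≤ C' * (‖y + z‖ ^ 2 - ‖relaxedProj r 0 W (y + z')‖ ^ 2) := by
  obtain ⟨K, hK⟩ := exists_norm_le_mul_norm_starProjection V W
  have hκ : 0 < r * (2 - r) := mul_pos hr.1 (sub_pos.2 hr.2)
  set κ := r * (2 - r) with hκ_def
  refine ⟨2 * K ^ 2 / κ + (2 * K ^ 2 + 1) * C, by positivity,
    fun y hy z hz z' hz' hle hloss => ?_⟩
  set u := ‖W.starProjection (y + z')‖ with hu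
  have hproj : ‖W.starProjection y‖ ≤ u + ‖z‖ := calc
    ‖W.starProjection y‖ = ‖W.starProjection (y + z') - W.starProjection z'‖ := by
      rw [← map_sub, add_sub_cancel_right]
    _ ≤ u + ‖W.starProjection z'‖ := norm_sub_le _ _
    _ ≤ u + ‖z‖ := by gcongr; exact (W.norm_starProjection_apply_le z').trans hle
  have hy_sq : ‖y‖ ^ 2 ≤ 2 * K ^ 2 * (u ^ 2 + ‖z‖ ^ 2) := calc
    ‖y‖ ^ 2 ≤ (K * ‖W.starProjection y‖) ^ 2 := by gcongr; exact hK y hy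
    _ = K ^ 2 * ‖W.starProjection y‖ ^ 2 := mul_pow _ _ _
    _ ≤ K ^ 2 * (u + ‖z‖) ^ 2 := by gcongr
    _ ≤ K ^ 2 * (2 * (u ^ 2 + ‖z‖ ^ 2)) := by gcongr; exact add_sq_le
    _ = 2 * K ^ 2 * (u ^ 2 + ‖z‖ ^ 2) := by ring
  have hz_loss : 0 ≤ ‖z‖ ^ 2 - ‖z'‖ ^ 2 := sub_nonneg.2 (by gcongr)
  rw [norm_relaxedProj_zero_sq, norm_add_sq_of_mem_orthogonal hy.2 hz,
    norm_add_sq_of_mem_orthogonal hy.2 hz', ← hu, ← hκ_def]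
  calc ‖y‖ ^ 2 + ‖z‖ ^ 2
      ≤ 2 * K ^ 2 * u ^ 2 + (2 * K ^ 2 + 1) * ‖z‖ ^ 2 := by linarith
    _ ≤ 2 * K ^ 2 * u ^ 2 + (2 * K ^ 2 + 1) * (C * (‖z‖ ^ 2 - ‖z'‖ ^ 2)) := by gcongr
    _ = 2 * K ^ 2 / κ * (κ * u ^ 2) + (2 * K ^ 2 + 1) * C * (‖z‖ ^ 2 - ‖z'‖ ^ 2) := by
      field_simp
    _ ≤ (2 * K ^ 2 / κ + (2 * K ^ 2 + 1) * C) * (κ * u ^ 2) +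
        (2 * K ^ 2 / κ + (2 * K ^ 2 + 1) * C) * (‖z‖ ^ 2 - ‖z'‖ ^ 2) := by
      gcongr
      · exact le_add_of_nonneg_right (by positivity)
      · exact le_add_of_nonneg_left (by positivity)
    _ = (2 * K ^ 2 / κ + (2 * K ^ 2 + 1) * C) *
        (‖y‖ ^ 2 + ‖z‖ ^ 2 - (‖y‖ ^ 2 + ‖z'‖ ^ 2 - κ * u ^ 2)) := by ring

end Contraction

section Words

theorem exists_eq_append_cons_of_toFinset_eq {ι : Type*} [DecidableEq ι] {S : Finset ι}
    (hS : S.Nonempty) {w : List ι} (hw : w.toFinset = S) :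
    ∃ v, ∃ i ∈ S, ∃ u, w = v ++ i :: u ∧ u.toFinset = S.erase i := by
  induction w with
  | nil => exact absurd hw.symm hS.ne_empty
  | cons i w ih =>
    rw [List.toFinset_cons] at hw
    by_cases hi : i ∈ w.toFinset
    · obtain ⟨v, j, hj, u, rfl, hu⟩ := ih (by rwa [Finset.insert_eq_of_mem hi] at hw)
      exact ⟨i :: v, j, hj, u, rfl, hu⟩
    · exact ⟨[], i, hw ▸ Finset.mem_insert_self i _, w, rfl, by
        rw [← hw, Finset.erase_insert hi]⟩

theorem le_sup_of_toFinset_subset {ι α : Type*} [DecidableEq ι] [SemilatticeSup α] [OrderBot α]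
    {f : ι → α} {S : Finset ι} {w : List ι} (hw : w.toFinset ⊆ S) : ∀ i ∈ w, f i ≤ S.sup f :=
  fun _ hi => Finset.le_sup (hw (List.mem_toFinset.2 hi))

variable {ι X : Type*} [NormedAddCommGroup X] [InnerProductSpace ℝ X]
variable {r : ℝ} {c : ι → X} {W : ι → Submodule ℝ X} [∀ i, (W i).HasOrthogonalProjection]

/-- The product of the `r`-relaxed projections onto the affine subspaces `c i + (W i)ᗮ` along a
word. The last letter acts first. For `c = 0` this is the linear part of the product. -/
noncomputable def relaxedProjWord (r : ℝ) (c : ι → X) (W : ι → Submodule ℝ X)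
    [∀ i, (W i).HasOrthogonalProjection] (w : List ι) (x : X) : X :=
  w.foldr (fun i => relaxedProj r (c i) (W i)) x

@[simp]
theorem relaxedProjWord_nil (x : X) : relaxedProjWord r c W [] x = x := rfl

@[simp]
theorem relaxedProjWord_cons (i : ι) (w : List ι) (x : X) :
    relaxedProjWord r c W (i :: w) x = relaxedProj r (c i) (W i) (relaxedProjWord r c W w x) := rfl

theorem relaxedProjWord_append (v w : List ι) (x : X) :
    relaxedProjWord r c W (v ++ w) x = relaxedProjWord r c W v (relaxedProjWord r c W w x) :=
  List.foldr_append

theorem relaxedProjWord_add (w : List ι) (x y : X) :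
    relaxedProjWord r c W w (x + y) = relaxedProjWord r 0 W w x + relaxedProjWord r c W w y := by
  induction w with
  | nil => rfl
  | cons i w ih => rw [relaxedProjWord_cons, ih, relaxedProj_add]; rfl

theorem relaxedProjWord_eq_add (w : List ι) (x : X) :
    relaxedProjWord r c W w x = relaxedProjWord r 0 W w x + relaxedProjWord r c W w 0 := by
  rw [← relaxedProjWord_add, add_zero]

theorem norm_relaxedProjWord_zero_le (hr : r ∈ Set.Icc 0 2) (w : List ι) (x : X) :
    ‖relaxedProjWord r 0 W w x‖ ≤ ‖x‖ := by
  induction w with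
  | nil => rfl
  | cons i w ih => exact (norm_relaxedProj_zero_le hr _).trans ih

theorem norm_relaxedProjWord_le (hr : r ∈ Set.Icc 0 2) (w : List ι) (x : X) :
    ‖relaxedProjWord r c W w x‖ ≤ ‖x‖ + ‖relaxedProjWord r c W w 0‖ := by
  rw [relaxedProjWord_eq_add]
  exact norm_add_le_of_le (norm_relaxedProjWord_zero_le hr w x) le_rfl

theorem relaxedProjWord_mem {V : Submodule ℝ X} {w : List ι} (hw : ∀ i ∈ w, W i ≤ V) {x : X}
    (hx : x ∈ V) : relaxedProjWord r c W w x ∈ V := by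
  induction w with
  | nil => exact hx
  | cons i w ih =>
    rw [List.forall_mem_cons] at hw
    exact relaxedProj_mem hw.1 (ih hw.2)

theorem relaxedProjWord_zero_of_mem_orthogonal {V : Submodule ℝ X} {w : List ι}
    (hw : ∀ i ∈ w, W i ≤ V) {x : X} (hx : x ∈ Vᗮ) : relaxedProjWord r 0 W w x = x := by
  induction w with
  | nil => rfl
  | cons i w ih =>
    rw [List.forall_mem_cons] at hw
    rw [relaxedProjWord_cons, ih hw.2]
    exact relaxedProj_zero_of_mem_orthogonal (Submodule.orthogonal_le hw.1 hx)

end Words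

section RandomProducts

variable {ι X : Type*} [DecidableEq ι] [NormedAddCommGroup X] [InnerProductSpace ℝ X]
variable {r : ℝ} {c : ι → X} {W : ι → Submodule ℝ X} [∀ i, FiniteDimensional ℝ (W i)]

theorem exists_norm_sq_le_mul_loss_cons (hr : r ∈ Set.Ioo 0 2) {S : Finset ι} {i : ι} (hi : i ∈ S)
    {C : ℝ} (hC0 : 0 ≤ C) (hC : ∀ u : List ι, u.toFinset = S.erase i → ∀ z ∈ (S.erase i).sup W,
      ‖z‖ ^ 2 ≤ C * (‖z‖ ^ 2 - ‖relaxedProjWord r 0 W u z‖ ^ 2)) :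
    ∃ C' : ℝ, 0 ≤ C' ∧ ∀ u : List ι, u.toFinset = S.erase i → ∀ x ∈ S.sup W,
      ‖x‖ ^ 2 ≤ C' * (‖x‖ ^ 2 - ‖relaxedProjWord r 0 W (i :: u) x‖ ^ 2) := by
  have hsup : S.sup W = (S.erase i).sup W ⊔ W i := by
    rw [sup_comm, ← Finset.sup_insert, Finset.insert_erase hi]
  obtain ⟨C', hC'0, hC'⟩ := exists_norm_sq_le_mul_loss ((S.erase i).sup W) (W i) hr hC0
  refine ⟨C', hC'0, fun u hu x hx => ?_⟩
  have hu_le : ∀ j ∈ u, W j ≤ (S.erase i).sup W := le_sup_of_toFinset_subset hu.subset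
  obtain ⟨z, hz, y, hy, rfl⟩ := ((S.erase i).sup W).exists_add_mem_mem_orthogonal x
  rw [hsup] at hx
  have hy' : y ∈ (S.erase i).sup W ⊔ W i :=
    (Submodule.add_mem_iff_right _ (Submodule.mem_sup_left hz)).1 hx
  rw [add_comm z y, relaxedProjWord_cons, relaxedProjWord_add,
    relaxedProjWord_zero_of_mem_orthogonal hu_le hy]
  exact hC' y ⟨hy', hy⟩ z hz _ (relaxedProjWord_mem hu_le hz)
    (norm_relaxedProjWord_zero_le (Set.Ioo_subset_Icc_self hr) u z) (hC u hu z hz)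

theorem exists_norm_sq_le_mul_loss_word (hr : r ∈ Set.Ioo 0 2) (S : Finset ι) :
    ∃ C : ℝ, 0 ≤ C ∧ ∀ w : List ι, w.toFinset = S → ∀ x ∈ S.sup W,
      ‖x‖ ^ 2 ≤ C * (‖x‖ ^ 2 - ‖relaxedProjWord r 0 W w x‖ ^ 2) := by
  induction S using Finset.strongInduction with
  | H S ih =>
    rcases S.eq_empty_or_nonempty with rfl | hS
    · refine ⟨0, le_rfl, fun w _ x hx => ?_⟩
      rw [Finset.sup_empty, Submodule.mem_bot] at hx
      simp [hx]
    choose! C hC0 hC using fun i (hi : i ∈ S) =>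
      (ih _ (Finset.erase_ssubset hi)).elim fun _ hC =>
        exists_norm_sq_le_mul_loss_cons hr hi hC.1 hC.2
    obtain ⟨M, hM⟩ := (S.image C).exists_le
    rw [Finset.forall_mem_image] at hM
    obtain ⟨j, hj⟩ := hS
    refine ⟨M, (hC0 j hj).trans (hM hj), fun w hw x hx => ?_⟩
    obtain ⟨v, i, hi, u, rfl, hu⟩ := exists_eq_append_cons_of_toFinset_eq ⟨j, hj⟩ hw
    have hr' := Set.Ioo_subset_Icc_self hr
    have hle := norm_relaxedProjWord_zero_le (W := W) hr' (i :: u) x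
    calc ‖x‖ ^ 2
        ≤ C i * (‖x‖ ^ 2 - ‖relaxedProjWord r 0 W (i :: u) x‖ ^ 2) := hC i hi u hu x hx
      _ ≤ M * (‖x‖ ^ 2 - ‖relaxedProjWord r 0 W (i :: u) x‖ ^ 2) := by
        gcongr
        · exact sub_nonneg.2 (by gcongr)
        · exact hM hi
      _ ≤ M * (‖x‖ ^ 2 - ‖relaxedProjWord r 0 W (v ++ i :: u) x‖ ^ 2) := by
        rw [relaxedProjWord_append]
        gcongr
        · exact (hC0 j hj).trans (hM hj)
        · exact norm_relaxedProjWord_zero_le hr' v _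

theorem exists_norm_relaxedProjWord_zero_le_mul (hr : r ∈ Set.Ioo 0 2) (S : Finset ι) :
    ∃ q ∈ Set.Ico (0 : ℝ) 1, ∀ w : List ι, w.toFinset = S → ∀ x ∈ S.sup W,
      ‖relaxedProjWord r 0 W w x‖ ≤ q * ‖x‖ := by
  obtain ⟨C, hC0, hC⟩ := exists_norm_sq_le_mul_loss_word (W := W) hr S
  refine ⟨√(C / (C + 1)), ⟨Real.sqrt_nonneg _, ?_⟩, fun w hw x hx => ?_⟩
  · rw [Real.sqrt_lt' one_pos, one_pow, div_lt_one (by positivity)]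
    exact lt_add_one C
  have hsq : ‖relaxedProjWord r 0 W w x‖ ^ 2 ≤ C / (C + 1) * ‖x‖ ^ 2 := by
    rw [div_mul_eq_mul_div, le_div_iff₀ (by positivity)]
    have hle : ‖relaxedProjWord r 0 W w x‖ ^ 2 ≤ ‖x‖ ^ 2 := by
      gcongr
      exact norm_relaxedProjWord_zero_le (Set.Ioo_subset_Icc_self hr) w x
    linarith [hC w hw x hx]
  rw [← Real.sqrt_sq (norm_nonneg x), ← Real.sqrt_mul' _ (sq_nonneg _)]
  exact Real.le_sqrt_of_sq_le hsq

theorem norm_relaxedProjWord_le_of_blocks (hr : r ∈ Set.Icc 0 2) {S : Finset ι} {q D B : ℝ}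
    (hq0 : 0 ≤ q) (hD0 : 0 ≤ D) (hB : q * B + D ≤ B)
    (hq : ∀ w : List ι, w.toFinset = S → ∀ x ∈ S.sup W, ‖relaxedProjWord r 0 W w x‖ ≤ q * ‖x‖)
    (hD : ∀ w : List ι, w.toFinset ⊂ S → ‖relaxedProjWord r c W w 0‖ ≤ D)
    (hD' : ∀ i ∈ S, ∀ u : List ι, u.toFinset = S.erase i → ‖relaxedProjWord r c W (i :: u) 0‖ ≤ D)
    {w : List ι} (hw : w.toFinset ⊆ S) {x : X} (hx : x ∈ S.sup W) (hxB : ‖x‖ ≤ B) :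
    ‖relaxedProjWord r c W w x‖ ≤ B + D := by
  induction hn : w.length using Nat.strong_induction_on generalizing w x with
  | _ n ih =>
    rcases hw.ssubset_or_eq with hlt | heq
    · exact (norm_relaxedProjWord_le hr w x).trans (add_le_add hxB (hD w hlt))
    rcases S.eq_empty_or_nonempty with rfl | hS
    · rw [List.toFinset_eq_empty_iff] at heq
      rw [heq, relaxedProjWord_nil]
      exact hxB.trans (le_add_of_nonneg_right hD0)
    obtain ⟨v, i, hi, u, rfl, hu⟩ := exists_eq_append_cons_of_toFinset_eq hS heq
    have hblock : (i :: u).toFinset = S := by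
      rw [List.toFinset_cons, hu, Finset.insert_erase hi]
    have hvw : v.toFinset ⊆ (v ++ i :: u).toFinset := by
      rw [List.toFinset_append]
      exact Finset.subset_union_left
    rw [relaxedProjWord_append]
    refine ih v.length (by simp [← hn]) (hvw.trans hw)
      (relaxedProjWord_mem (le_sup_of_toFinset_subset hblock.subset) hx) ?_ rfl
    calc ‖relaxedProjWord r c W (i :: u) x‖
        = ‖relaxedProjWord r 0 W (i :: u) x + relaxedProjWord r c W (i :: u) 0‖ := by
          rw [← relaxedProjWord_eq_add]
      _ ≤ q * ‖x‖ + D := norm_add_le_of_le (hq _ hblock x hx) (hD' i hi u hu)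
      _ ≤ q * B + D := by gcongr
      _ ≤ B := hB

theorem exists_norm_relaxedProjWord_origin_le (hr : r ∈ Set.Ioo 0 2) (c : ι → X)
    (W : ι → Submodule ℝ X) [∀ i, FiniteDimensional ℝ (W i)] (S : Finset ι) :
    ∃ K : ℝ, ∀ w : List ι, w.toFinset ⊆ S → ‖relaxedProjWord r c W w 0‖ ≤ K := by
  have hr' := Set.Ioo_subset_Icc_self hr
  induction S using Finset.strongInduction with
  | H S ih =>
    choose! K hK using ih
    obtain ⟨M, hM⟩ := (S.ssubsets.image K).exists_le
    obtain ⟨N, hN⟩ := (S.image fun i => ‖relaxedProj r (c i) (W i) 0‖).exists_le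
    rw [Finset.forall_mem_image] at hM hN
    obtain ⟨q, ⟨hq0, hq1⟩, hq⟩ := exists_norm_relaxedProjWord_zero_le_mul (W := W) hr S
    set D := max M 0 + max N 0
    have hD0 : 0 ≤ D := by positivity
    have hproper {w : List ι} (hw : w.toFinset ⊂ S) : ‖relaxedProjWord r c W w 0‖ ≤ max M 0 :=
      (hK _ hw w subset_rfl).trans ((hM (Finset.mem_ssubsets.2 hw)).trans (le_max_left _ _))
    have hblock (i) (hi : i ∈ S) (u : List ι) (hu : u.toFinset = S.erase i) :
        ‖relaxedProjWord r c W (i :: u) 0‖ ≤ D := calc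
      ‖relaxedProjWord r c W (i :: u) 0‖
          ≤ ‖relaxedProjWord r c W u 0‖ + ‖relaxedProj r (c i) (W i) 0‖ :=
        norm_relaxedProjWord_le hr' [i] _
      _ ≤ D := add_le_add (hproper (hu ▸ Finset.erase_ssubset hi))
        ((hN hi).trans (le_max_left _ _))
    have hB : q * (D / (1 - q)) + D ≤ D / (1 - q) := by
      have := sub_pos.2 hq1
      field_simp
      linarith
    refine ⟨D / (1 - q) + D, fun w hw => ?_⟩
    refine norm_relaxedProjWord_le_of_blocks hr' hq0 hD0 hB hq
      (fun w hw => (hproper hw).trans (le_add_of_nonneg_right (le_max_right _ _))) hblock hw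
      (Submodule.zero_mem _) ?_
    rw [norm_zero]
    exact div_nonneg hD0 (sub_nonneg.2 hq1.le)

end RandomProducts

theorem exists_isBounded_mapsTo_relaxedProj {ι X : Type*} [NormedAddCommGroup X]
    [InnerProductSpace ℝ X] {r : ℝ} (hr : r ∈ Set.Ioo 0 2) (c : ι → X) (W : ι → Submodule ℝ X)
    [∀ i, FiniteDimensional ℝ (W i)] (S : Finset ι) (x₀ : X) :
    ∃ B : Set X, x₀ ∈ B ∧ Bornology.IsBounded B ∧
      ∀ i ∈ S, ∀ μ ∈ Set.Icc 0 r, Set.MapsTo (relaxedProj μ (c i) (W i)) B B := by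
  classical
  obtain ⟨K, hK⟩ := exists_norm_relaxedProjWord_origin_le hr c W S
  let orbit : Set X := (fun w => relaxedProjWord r c W w x₀) '' {w | w.toFinset ⊆ S}
  have hfull {i : ι} (hi : i ∈ S) :
      Set.MapsTo (relaxedProj r (c i) (W i)) (convexHull ℝ orbit) (convexHull ℝ orbit) := by
    refine convexHull_min ?_ ((convex_convexHull ℝ orbit).affine_preimage _)
    rintro _ ⟨w, hw, rfl⟩
    refine subset_convexHull ℝ orbit ⟨i :: w, ?_, rfl⟩
    rw [Set.mem_ofPred_eq, List.toFinset_cons]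
    exact Finset.insert_subset hi hw
  refine ⟨convexHull ℝ orbit, subset_convexHull ℝ orbit ⟨[], Finset.empty_subset S, rfl⟩,
    isBounded_convexHull.2 ?_, fun i hi μ hμ x hx => ?_⟩
  · refine isBounded_iff_forall_norm_le.2 ⟨‖x₀‖ + K, ?_⟩
    rintro _ ⟨w, hw, rfl⟩
    exact (norm_relaxedProjWord_le (Set.Ioo_subset_Icc_self hr) w x₀).trans (by grw [hK w hw])
  · rw [relaxedProj_eq_lineMap hr.1.ne']
    exact (convex_convexHull ℝ orbit).lineMap_mem hx (hfull hi hx)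
      ⟨div_nonneg hμ.1 hr.1.le, (div_le_one hr.1).2 hμ.2⟩

section Polyhedral

variable {X : Type*} [NormedAddCommGroup X] [InnerProductSpace ℝ X]

theorem isNearestPoint_iff_inner_le_zero {C : Set X} (hC : Convex ℝ C) {x p : X} (hp : p ∈ C) :
    IsNearestPoint C x p ↔ ∀ z ∈ C, inner ℝ (x - p) (z - p) ≤ 0 := by
  have : Nonempty C := ⟨⟨p, hp⟩⟩
  have hbdd : BddBelow (Set.range fun z : C => ‖x - z‖) :=
    ⟨0, Set.forall_mem_range.2 fun _ => norm_nonneg _⟩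
  rw [← norm_eq_iInf_iff_real_inner_le_zero hC hp]
  refine ⟨fun h => le_antisymm (le_ciInf fun z => h.2 z z.2) (ciInf_le hbdd ⟨p, hp⟩),
    fun h => ⟨hp, fun z hz => h ▸ ciInf_le hbdd ⟨z, hz⟩⟩⟩

theorem isNearestPoint_projector [CompleteSpace X] {C : Set X} (hne : C.Nonempty)
    (hcl : IsClosed C) (hconv : Convex ℝ C) (x : X) : IsNearestPoint C x (projector C x) := by
  have hex : ∃ p, IsNearestPoint C x p := by
    obtain ⟨p, hp, hmin⟩ := exists_norm_eq_iInf_of_complete_convex hne hcl.isComplete hconv x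
    exact ⟨p, (isNearestPoint_iff_inner_le_zero hconv hp).2
      ((norm_eq_iInf_iff_real_inner_le_zero hconv hp).1 hmin)⟩
  rw [projector, dif_pos hex]
  exact hex.choose_spec

theorem convex_setOf_forall_inner_le (F : Finset (X × ℝ)) :
    Convex ℝ {x : X | ∀ h ∈ F, inner ℝ h.1 x ≤ h.2} := by
  simp only [Set.ofPred_forall]
  exact convex_iInter₂ fun h _ => convex_halfSpace_le (innerₛₗ ℝ h.1).isLinear h.2

theorem IsPolyhedralSet.exists_finset {C : Set X} (hC : IsPolyhedralSet C) :
    ∃ F : Finset (X × ℝ), C = {x | ∀ h ∈ F, inner ℝ h.1 x ≤ h.2} := by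
  classical
  obtain ⟨𝓗, hfin, hhalf, rfl⟩ := hC
  choose! a β _ hH using hhalf
  refine ⟨hfin.toFinset.image fun H => (a H, β H), Set.ext fun x => ?_⟩
  simp only [Finset.forall_mem_image, Set.Finite.mem_toFinset, Set.mem_sInter, Set.mem_ofPred_eq]
  exact forall₂_congr fun H hHm => by rw [Set.ext_iff.1 (hH H hHm) x, Set.mem_ofPred_eq]

open Classical in
/-- The inequalities `⟪h.1, ·⟫ ≤ h.2` of the system `F` that are active at `p`. -/
noncomputable def activeConstraints (F : Finset (X × ℝ)) (p : X) : Finset (X × ℝ) :=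
  {h ∈ F | inner ℝ h.1 p = h.2}

theorem mem_activeConstraints {F : Finset (X × ℝ)} {p : X} {h : X × ℝ} :
    h ∈ activeConstraints F p ↔ h ∈ F ∧ inner ℝ h.1 p = h.2 :=
  Finset.mem_filter

open Classical in
/-- The finite set of normals of the inequalities of `F` that are active at `p`. -/
noncomputable def activeNormals (F : Finset (X × ℝ)) (p : X) : Finset X :=
  (activeConstraints F p).image Prod.fst

theorem mem_orthogonal_span_activeNormals {F : Finset (X × ℝ)} {p d : X} :
    d ∈ (Submodule.span ℝ (activeNormals F p : Set X))ᗮ ↔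
      ∀ h ∈ activeConstraints F p, inner ℝ h.1 d = 0 := by
  classical
  rw [← Submodule.span_singleton_le_iff_mem, ← Submodule.isOrtho_iff_le, Submodule.isOrtho_comm,
    Submodule.isOrtho_span]
  simp [activeNormals]

theorem eventually_add_smul_mem_of_mem_orthogonal {F : Finset (X × ℝ)} {p d : X}
    (hp : ∀ h ∈ F, inner ℝ h.1 p ≤ h.2)
    (hd : d ∈ (Submodule.span ℝ (activeNormals F p : Set X))ᗮ) :
    ∀ᶠ t : ℝ in nhds 0, ∀ h ∈ F, inner ℝ h.1 (p + t • d) ≤ h.2 := by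
  refine (Filter.eventually_all_finset F).2 fun h hF => ?_
  rcases (hp h hF).eq_or_lt with hactive | hslack
  · refine Filter.Eventually.of_forall fun t => le_of_eq ?_
    rw [inner_add_right, real_inner_smul_right, hactive,
      mem_orthogonal_span_activeNormals.1 hd h (mem_activeConstraints.2 ⟨hF, hactive⟩), mul_zero,
      add_zero]
  · have hcont : Continuous fun t : ℝ => inner ℝ h.1 (p + t • d) := by fun_prop
    have hlim : inner ℝ h.1 (p + (0 : ℝ) • d) < h.2 := by rwa [zero_smul, add_zero]
    exact ((hcont.tendsto 0).eventually_lt_const hlim).mono fun t ht => ht.le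

/-- By the double orthogonal complement, it suffices that `x - p` is orthogonal to every `d`
orthogonal to the active normals; both `p + t • d` and `p - t • d` stay in the polyhedron. -/
theorem IsNearestPoint.sub_mem_span_activeNormals {F : Finset (X × ℝ)} {x p : X}
    (hp : IsNearestPoint {y | ∀ h ∈ F, inner ℝ h.1 y ≤ h.2} x p) :
    x - p ∈ Submodule.span ℝ (activeNormals F p : Set X) := by
  have hle {d : X} (hd : d ∈ (Submodule.span ℝ (activeNormals F p : Set X))ᗮ) :
      inner ℝ (x - p) d ≤ 0 := by
    obtain ⟨t, hmem, ht⟩ : ∃ t : ℝ, (∀ h ∈ F, inner ℝ h.1 (p + t • d) ≤ h.2) ∧ 0 < t :=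
      (((eventually_add_smul_mem_of_mem_orthogonal hp.1 hd).filter_mono
        nhdsWithin_le_nhds).and self_mem_nhdsWithin).exists (f := nhdsWithin 0 (Set.Ioi 0))
    have h := (isNearestPoint_iff_inner_le_zero (convex_setOf_forall_inner_le F) hp.1).1 hp _ hmem
    rw [add_sub_cancel_left, real_inner_smul_right] at h
    exact nonpos_of_mul_nonpos_right h ht
  rw [← Submodule.orthogonal_orthogonal (Submodule.span ℝ (activeNormals F p : Set X)),
    Submodule.mem_orthogonal']
  intro d hd
  have hneg := hle (Submodule.neg_mem _ hd)
  rw [inner_neg_right, neg_nonpos] at hneg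
  exact le_antisymm (hle hd) hneg

theorem IsPolyhedralSet.exists_finite_affine {C : Set X} (hC : IsPolyhedralSet C) :
    ∃ 𝒜 : Set (X × Finset X), 𝒜.Finite ∧ ∀ x p, IsNearestPoint C x p → ∃ A ∈ 𝒜,
      p - A.1 ∈ (Submodule.span ℝ (A.2 : Set X))ᗮ ∧ x - p ∈ Submodule.span ℝ (A.2 : Set X) := by
  obtain ⟨F, rfl⟩ := hC.exists_finset
  let rep : Finset (X × ℝ) → X := Function.invFun (activeConstraints F)
  have hrep (p : X) : activeConstraints F (rep (activeConstraints F p)) = activeConstraints F p :=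
    Function.invFun_eq ⟨p, rfl⟩
  have hfin : (Set.range (activeConstraints F)).Finite :=
    F.powerset.finite_toSet.subset <| Set.range_subset_iff.2 fun p =>
      Finset.mem_powerset.2 fun _ h => (mem_activeConstraints.1 h).1
  refine ⟨(fun c => (c, activeNormals F c)) '' (rep '' Set.range (activeConstraints F)),
    (hfin.image _).image _, fun x p hp => ?_⟩
  set c := rep (activeConstraints F p) with hc
  refine ⟨(c, activeNormals F c), ⟨c, ⟨_, ⟨p, rfl⟩, rfl⟩, rfl⟩, ?_, ?_⟩
  · refine mem_orthogonal_span_activeNormals.2 fun h hh => ?_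
    have hp_active := (mem_activeConstraints.1 (hrep p ▸ hh)).2
    rw [inner_sub_right, hp_active, (mem_activeConstraints.1 hh).2, sub_self]
  · have hnormals : activeNormals F c = activeNormals F p := by
      rw [activeNormals, activeNormals, hc, hrep]
    rw [hnormals]
    exact hp.sub_mem_span_activeNormals

theorem exists_isBounded_mapsTo_relaxedProjectors [CompleteSpace X] {𝒞 : Set (Set X)}
    (h𝒞_fin : 𝒞.Finite) (h𝒞 : ∀ C ∈ 𝒞, C.Nonempty ∧ IsPolyhedralSet C) {lam : ℝ}
    (hlam : lam < 2) (x₀ : X) :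
    ∃ B : Set X, x₀ ∈ B ∧ Bornology.IsBounded B ∧
      ∀ R ∈ relaxedProjectors 𝒞 (Set.Icc 0 lam), Set.MapsTo R B B := by
  classical
  choose! 𝒜 h𝒜_fin h𝒜 using fun C hC => (h𝒞 C hC).2.exists_finite_affine
  have hfin : (⋃ C ∈ 𝒞, 𝒜 C).Finite := h𝒞_fin.biUnion h𝒜_fin
  obtain ⟨B, hx₀, hB, hmaps⟩ := exists_isBounded_mapsTo_relaxedProj (r := max lam 1)
    ⟨lt_max_of_lt_right one_pos, max_lt hlam one_lt_two⟩ Prod.fst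
    (fun A : X × Finset X => Submodule.span ℝ (A.2 : Set X)) hfin.toFinset x₀
  refine ⟨B, hx₀, hB, ?_⟩
  rintro _ ⟨C, hC, μ, hμ, rfl⟩ x hx
  obtain ⟨A, hA, hpA, hxp⟩ := h𝒜 C hC x _
    (isNearestPoint_projector (h𝒞 C hC).1 (h𝒞 C hC).2.isClosed (h𝒞 C hC).2.convex x)
  have hμ' : μ ∈ Set.Icc 0 (max lam 1) := ⟨hμ.1, hμ.2.trans (le_max_left _ _)⟩
  change (1 - μ) • x + μ • projector C x ∈ B
  rw [← relaxedProj_eq_of_sub_mem hpA hxp]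
  exact hmaps A (hfin.mem_toFinset.2 (Set.mem_biUnion hC hA)) μ hμ' hx

end Polyhedral

theorem theorem2p5_general {X : Type*} [NormedAddCommGroup X] [InnerProductSpace ℝ X]
    [CompleteSpace X] {𝒞 : Set (Set X)} (h𝒞_fin : 𝒞.Finite)
    (h𝒞 : ∀ C ∈ 𝒞, C.Nonempty ∧ IsPolyhedralSet C) {lam : ℝ} (hlam : lam < 2)
    {x : ℕ → X} {R : ℕ → X → X} (hR : ∀ n, R n ∈ relaxedProjectors 𝒞 (Set.Icc 0 lam))
    (hx : ∀ n, x (n + 1) = R n (x n)) :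
    Bornology.IsBounded (Set.range x) := by
  obtain ⟨B, hx₀, hB, hmaps⟩ := exists_isBounded_mapsTo_relaxedProjectors h𝒞_fin h𝒞 hlam (x 0)
  refine hB.subset (Set.range_subset_iff.2 fun n => ?_)
  induction n with
  | zero => exact hx₀
  | succ n ih => exact hx n ▸ hmaps (R n) (hR n) ih

theorem theorem2p5 {X : Type*} [NormedAddCommGroup X] [InnerProductSpace ℝ X]
    [FiniteDimensional ℝ X]
    (𝒞 : Set (Set X)) (h𝒞_fin : 𝒞.Finite) (h𝒞_ne : 𝒞.Nonempty)
    (h𝒞 : ∀ C ∈ 𝒞, C.Nonempty ∧ IsPolyhedralSet C)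
    (lam : ℝ) (hlam : lam ∈ Set.Ico (0 : ℝ) 2)
    (x : ℕ → X) (R : ℕ → X → X)
    (hR : ∀ n, R n ∈ relaxedProjectors 𝒞 (Set.Icc 0 lam))
    (hx : ∀ n, x (n + 1) = R n (x n)) :
    Bornology.IsBounded (Set.range x) := by
  have := FiniteDimensional.complete ℝ X
  exact theorem2p5_general h𝒞_fin h𝒞 hlam.2 hR hx
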